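/- Let $\mathbb{D}^3=\{(x,y,z)\in\mathbb{R}^3: x^2+y^2+z^2\le 1\}$, let $N=(0,0,1)$ and $S=(0,0,-1)$, and for $c\in[-1,1]$ let $\mathbb{D}^2_c=\{(x,y,z)\in\mathbb{D}^3: z=c\}$. Give the set $\mathrm{Diff}^\infty(\mathbb{D}^3)$ of $C^\infty$ diffeomorphisms of $\mathbb{D}^3$ onto itself (smooth up to the boundary) the $C^\infty$ topology, that is, uniform convergence on $\mathbb{D}^3$ of the derivatives of every order, and let $h$ denote topological entropy. **Theorem E.** There exists $F\in\mathrm{Diff}^\infty(\mathbb{D}^3)$ which is a discontinuity point of $h:\mathrm{Diff}^\infty(\mathbb{D}^3)\to[0,\infty]$; more precisely, $h$ is not lower semicontinuous at $F$. Moreover, $F$ can be chosen so that: 1. $F$ maps every horizontal disc $\mathbb{D}^2_c$ to itself; the middle disc $\mathbb{D}^2_0$ contains a two-symbol horseshoe of $F$, i.e. a compact $F$-invariant set on which $F$ is topologically conjugate to the full shift on $\{0,1\}^{\mathbb{Z}}$; and $h(F)\ge\log 2$. 2. There is a $C^\infty$ flow $(\phi_\tau)_{\tau\in\mathbb{R}}$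 on $\mathbb{D}^3$ whose only singularities are $N$ and $S$, such that every other point has $\alpha$-limit set $\{N\}$ and $\omega$-limit set $\{S\}$, and such that for every $\tau>0$ and $c\in(-1,1)$ the map $\phi_\tau$ sends $\mathbb{D}^2_c$ onto some $\mathbb{D}^2_d$ with $-1<d<c$, for which the diffeomorphisms $G_\tau=\phi_\tau\circ F$ satisfy: $G_\tau\to F$ in the $C^\infty$ topology as $\tau\to0^+$, and for every $\tau>0$ the nonwandering set of $G_\tau$ is $\{N,S\}$ and $h(G_\tau)=0$. -/

import Mathlib

open Set Filter Topology Dynamics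
open scoped ContDiff Uniformity UniformConvergence

noncomputable section

namespace BallDynamics

/-- Euclidean three-space. -/
abbrev E3 : Type := EuclideanSpace ℝ (Fin 3)

/-- The closed unit ball of `ℝ³`, as a set. -/
def ball3 : Set E3 := Metric.closedBall 0 1

/-- The closed unit ball of `ℝ³`, as a space. -/
abbrev B3 : Type := ↥ball3

/-- A self-map of the closed ball, seen as a map of `ℝ³`. Its values outside the ball are
irrelevant: it is only ever differentiated within the ball. -/
def ambient (f : B3 → B3) : E3 → E3 :=
  Function.extend Subtype.val (fun p => (f p : E3)) 0

theorem ambient_coe (f : B3 → B3) (p : B3) : ambient f (p : E3) = f p :=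
  Subtype.val_injective.extend_apply _ _ p

theorem ambient_comp (f g : B3 → B3) :
    EqOn (ambient (f ∘ g)) (ambient f ∘ ambient g) ball3 := by
  intro x hx
  have h : ∀ k : B3 → B3, ambient k x = k ⟨x, hx⟩ := fun k => ambient_coe k ⟨x, hx⟩
  simp only [Function.comp_apply, h, ambient_coe]

theorem ambient_mapsTo (f : B3 → B3) : MapsTo (ambient f) ball3 ball3 := by
  intro x hx
  have h : ambient f x = f ⟨x, hx⟩ := ambient_coe f ⟨x, hx⟩
  rw [h]
  exact (f ⟨x, hx⟩).2

/-- A self-map of the closed ball is smooth (up to and including the boundary sphere). -/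
def SmoothMap (f : B3 → B3) : Prop := ContDiffOn ℝ ∞ (ambient f) ball3

theorem SmoothMap.comp {f g : B3 → B3} (hf : SmoothMap f) (hg : SmoothMap g) :
    SmoothMap (f ∘ g) :=
  (ContDiffOn.comp (show ContDiffOn ℝ ∞ (ambient f) ball3 from hf)
    (show ContDiffOn ℝ ∞ (ambient g) ball3 from hg) (ambient_mapsTo g)).congr (ambient_comp f g)

/-- `C^∞` diffeomorphisms of the closed three-dimensional ball onto itself. -/
structure BallDiffeo where
  /-- the underlying bijection -/
  toEquiv : B3 ≃ B3
  smooth : SmoothMap toEquiv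
  smooth_symm : SmoothMap toEquiv.symm

namespace BallDiffeo

instance : CoeFun BallDiffeo (fun _ => B3 → B3) := ⟨fun f => f.toEquiv⟩

/-- Composition `f ∘ g`. -/
def comp (f g : BallDiffeo) : BallDiffeo where
  toEquiv := g.toEquiv.trans f.toEquiv
  smooth := by
    rw [Equiv.coe_trans]
    exact SmoothMap.comp f.smooth g.smooth
  smooth_symm := by
    rw [Equiv.symm_trans, Equiv.coe_trans]
    exact SmoothMap.comp g.smooth_symm f.smooth_symm

/-- The `k`-th derivative of `f`, as a function on the closed ball
with the structure of uniform convergence. -/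
def deriv (f : BallDiffeo) (k : ℕ) : B3 →ᵤ (E3 [×k]→L[ℝ] E3) :=
  UniformFun.ofFun fun p => iteratedFDerivWithin ℝ k (ambient f) ball3 (p : E3)

/-- The `C^∞` topology: uniform convergence on the closed ball of the derivatives of every
order `k = 0, 1, 2, …`. -/
instance : TopologicalSpace BallDiffeo :=
  TopologicalSpace.induced (fun f k => deriv f k)
    (inferInstance : TopologicalSpace (∀ k : ℕ, B3 →ᵤ (E3 [×k]→L[ℝ] E3)))

/-- The topological entropy of a diffeomorphism of the closed ball. -/
def entropy (f : BallDiffeo) : EReal := coverEntropy f (univ : Set B3)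

end BallDiffeo

/-- The third coordinate. -/
def height (p : B3) : ℝ := (p : E3) 2

/-- The horizontal disc at height `c`. -/
def slice (c : ℝ) : Set B3 := {p | height p = c}

/-- The north pole `(0, 0, 1)`. -/
def northPole : B3 := ⟨EuclideanSpace.single 2 1, by simp [ball3]⟩

/-- The south pole `(0, 0, -1)`. -/
def southPole : B3 := ⟨EuclideanSpace.single 2 (-1), by simp [ball3]⟩

/-- The nonwandering set of a map. -/
def nonwanderingSet {X : Type*} [TopologicalSpace X] (T : X → X) : Set X :=
  {x | ∀ U ∈ 𝓝 x, ∃ n : ℕ, 1 ≤ n ∧ ((T^[n] '' U) ∩ U).Nonempty}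

/-- `T` has a two-symbol horseshoe inside `D`: `h` is a homeomorphism from the space of two-sided
sequences of two symbols onto an invariant subset of `D`, conjugating the full shift to `T`. -/
def HasHorseshoeIn {X : Type*} [TopologicalSpace X] (T : X → X) (D : Set X) : Prop :=
  ∃ h : (ℤ → Fin 2) → X, IsEmbedding h ∧ range h ⊆ D ∧
    ∀ s : ℤ → Fin 2, T (h s) = h (fun n => s (n + 1))

/-- `φ` is a `C^∞` flow on the closed ball whose only singularities are the poles, all of whose
other orbits go from the north pole to the south pole, and whose positive time maps send every
horizontal disc onto a strictly lower one. -/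
structure IsNorthSouthFlow (φ : ℝ → BallDiffeo) : Prop where
  map_zero : ∀ p, φ 0 p = p
  map_add : ∀ s t p, φ (s + t) p = φ s (φ t p)
  smooth : ContDiffOn ℝ ∞ (fun q : ℝ × E3 => ambient (φ q.1) q.2) (univ ×ˢ ball3)
  singularity_iff : ∀ p, (∀ t, φ t p = p) ↔ p = northPole ∨ p = southPole
  alpha_limit : ∀ p, p ≠ northPole → p ≠ southPole →
    omegaLimit atBot (fun t x => φ t x) {p} = {northPole}
  omega_limit : ∀ p, p ≠ northPole → p ≠ southPole →
    omegaLimit atTop (fun t x => φ t x) {p} = {southPole}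
  slice_lower : ∀ τ > 0, ∀ c ∈ Ioo (-1 : ℝ) 1, ∃ d ∈ Ioo (-1 : ℝ) 1,
    d < c ∧ φ τ '' slice c = slice d

end BallDynamics

end

/-!
The example is a height-preserving map `F` with a horseshoe in the middle disc, perturbed by a flow
which pushes every horizontal disc downwards. However small the push, it destroys all recurrence
away from the poles, so that the positive entropy of `F` collapses to zero.

**The flow.** In the projective (Klein) model, the Lorentz boosts along the vertical axis,
`(x, y, z) ↦ (x, y, z cosh t - sinh t) / (cosh t - z sinh t)`, preserve the ball and map horizontal
discs to horizontal discs. On heights they act as Möbius transformations of `[-1, 1]` with the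
repelling fixed point `1` and the attracting fixed point `-1` (`boostHeight`). Every map `T` which
acts on heights as a boost with `t > 0`, in particular a boost composed with a height-preserving
map, has the poles as its nonwandering set (`nonwanderingSet_eq_poles`) and zero entropy
(`coverEntropy_eq_zero_of_boost`). For the entropy no variational principle is needed: an orbit
segment is determined, up to a given scale, by the time it leaves a small cap at the north pole and
by a segment of bounded length after that, since then it has reached a small cap at the south pole;
so the number of distinguishable segments of length `n` grows linearly.

**The horseshoe.** Near the origin of the middle disc `F` is `(u, v) ↦ (v, g v - u)`, a quarter turn
followed by a shear, so that orbits are solutions of `x (n + 1) + x (n - 1) = g (x n)`. With `g`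
affine of slope `17 / 4` on two intervals labelled `0` and `1`, the solution with a prescribed
itinerary `s` solves a linear recurrence and is given by the convolution of `s` with the Green
function `4 ^ (-|k|)` (`codedPoint`); this formula is the conjugacy. Separating the symbols at a
fixed scale gives `log 2 ≤ h(F)`. The shear is cut off to act inside the ball, and is built as an
iterate of a small perturbation of the identity, which makes it a diffeomorphism (`exists_shear`).

**Convergence.** The perturbed maps depend smoothly on time and space jointly, and the space
derivatives of a jointly smooth family are jointly continuous, hence uniformly close on the compact
ball (`tendsto_of_smooth_family`).
-/

namespace BallDynamics

/-! ### Topological entropy from counting orbit segments -/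

/-- Linear growth of the dynamical covering numbers forces zero entropy. -/
theorem coverEntropy_nonpos_of_linear_growth {X : Type*} [UniformSpace X] (T : X → X)
    (h : ∀ U ∈ 𝓤 X, ∃ C : ℕ, ∀ n : ℕ, coverMincard T univ U n ≤ ((C * (n + 1) : ℕ) : ℕ∞)) :
    coverEntropy T univ ≤ 0 := by
  refine iSup₂_le fun U hU => ?_
  obtain ⟨C, hC⟩ := h U hU
  refine EReal.le_of_forall_lt_iff_le.1 fun a ha => ?_
  have ha : 0 < a := by exact_mod_cast ha
  refine Eventually.expGrowthSup_le ?_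
  have hlim : Tendsto (fun n : ℕ => (C * (n + 1) : ℝ) * Real.exp (-a * n)) atTop (𝓝 0) := by
    have h1 : Tendsto (fun n : ℕ => (n : ℝ) * Real.exp (-a * n)) atTop (𝓝 0) := by
      have := (tendsto_rpow_mul_exp_neg_mul_atTop_nhds_zero 1 a ha).comp
        tendsto_natCast_atTop_atTop
      simpa [Function.comp_def] using this
    have h2 : Tendsto (fun n : ℕ => Real.exp (-a * n)) atTop (𝓝 0) := by
      have := (tendsto_rpow_mul_exp_neg_mul_atTop_nhds_zero 0 a ha).comp
        tendsto_natCast_atTop_atTop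
      simpa [Function.comp_def] using this
    have := (h1.add h2).const_mul (C : ℝ)
    simp only [add_zero, mul_zero] at this
    exact this.congr fun n => by ring
  filter_upwards [hlim.eventually (gt_mem_nhds one_pos)] with n hn
  have h3 : (C * (n + 1) : ℝ) ≤ Real.exp (a * n) := by
    rw [neg_mul, Real.exp_neg, ← div_eq_mul_inv, div_lt_one (Real.exp_pos _)] at hn
    exact hn.le
  calc ((coverMincard T univ U n : ℕ∞) : ENNReal) ≤ (((C * (n + 1) : ℕ) : ℕ∞) : ENNReal) :=
        ENat.toENNReal_mono (hC n)
    _ = ENNReal.ofReal (C * (n + 1) : ℝ) := by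
        rw [ENat.toENNReal_coe, ← ENNReal.ofReal_natCast]; push_cast; rfl
    _ ≤ ENNReal.ofReal (Real.exp (a * n)) := ENNReal.ofReal_le_ofReal h3
    _ = EReal.exp ((a : EReal) * n) := by
        rw [← EReal.exp_coe]; push_cast; rfl

/-- If a finite code determines an orbit segment up to `U`, it bounds the covering number. -/
theorem coverMincard_le_card_of_code {X ι : Type*} [Fintype ι] (T : X → X) (U : SetRel X X)
    (n : ℕ) (f : X → ι) (hf : ∀ x y, f x = f y → (x, y) ∈ dynEntourage T U n) :
    coverMincard T univ U n ≤ (Fintype.card ι : ℕ∞) := by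
  classical
  rcases isEmpty_or_nonempty X with hX | hX
  · rw [univ_eq_empty_iff.2 hX, coverMincard_empty]; exact zero_le
  let s : Finset X := Finset.univ.image (Function.invFun f)
  have hs : IsDynCoverOf T univ U n (s : Set X) := by
    intro x _
    refine ⟨Function.invFun f (f x), by simp [s], hf _ _ ?_⟩
    exact (Function.invFun_eq ⟨x, rfl⟩).symm
  refine hs.coverMincard_le_card.trans ?_
  exact_mod_cast Finset.card_image_le

/-- A map of a compact space has zero entropy if, at every scale, each orbit stays in one small set
`A` until it leaves it and then needs only a bounded time to be forever in another small set `B`.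
Up to the scale, an orbit segment is determined by its exit time from `A` and by a segment of
bounded length after the exit, so that the number of segments grows linearly. -/
theorem coverEntropy_nonpos_of_transit {X : Type*} [UniformSpace X] [CompactSpace X] (T : X → X)
    (h : ∀ U ∈ 𝓤 X, ∃ A B : Set X, A ×ˢ A ⊆ U ∧ B ×ˢ B ⊆ U ∧
      ∃ M : ℕ, ∀ x ∉ A, ∀ i ≥ M, T^[i] x ∈ B) :
    coverEntropy T univ ≤ 0 := by
  classical
  refine coverEntropy_nonpos_of_linear_growth T fun U hU => ?_
  obtain ⟨A, B, hA, hB, M, hM⟩ := h U hU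
  obtain ⟨V, hV, hVs, hVU⟩ := comp_symm_mem_uniformity_sets hU
  obtain ⟨s, hs⟩ := exists_isDynCoverOf_of_isCompact_invariant (T := T) isCompact_univ
    (mapsTo_univ T univ) hV M
  choose c hcs hc using fun x => hs (mem_univ x)
  refine ⟨s.card, fun n => ?_⟩
  have hex : ∀ x, ∃ i, n ≤ i ∨ T^[i] x ∉ A := fun x => ⟨n, Or.inl le_rfl⟩
  let j : X → ℕ := fun x => Nat.find (hex x)
  have hjn : ∀ x, j x < n + 1 := fun x => Nat.lt_succ_of_le (Nat.find_min' _ (Or.inl le_rfl))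
  have hjlt : ∀ x, ∀ i < j x, T^[i] x ∈ A := fun x i hi => by
    have := Nat.find_min (hex x) hi
    push Not at this
    exact this.2
  have hjB : ∀ x, j x < n → ∀ i ≥ j x + M, T^[i] x ∈ B := fun x hx i hi => by
    have h1 : T^[j x] x ∉ A := by
      rcases Nat.find_spec (hex x) with h | h
      · exact absurd hx (not_lt.2 h)
      · exact h
    have h2 := hM _ h1 (i - j x) (by omega)
    rwa [← Function.iterate_add_apply, Nat.sub_add_cancel (by omega)] at h2
  let f : X → ↥s × Fin (n + 1) := fun x => (⟨c (T^[j x] x), hcs _⟩, ⟨j x, hjn x⟩)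
  refine (coverMincard_le_card_of_code T U n f fun x y hxy => ?_).trans (by simp)
  simp only [f, Prod.mk.injEq, Subtype.mk.injEq, Fin.mk.injEq] at hxy
  obtain ⟨hcc, hj⟩ := hxy
  rw [mem_dynEntourage]
  intro i hi
  rcases lt_or_ge i (j x) with h1 | h1
  · exact hA ⟨hjlt x i h1, hjlt y i (hj ▸ h1)⟩
  rcases lt_or_ge i (j x + M) with h2 | h2
  · have hx := mem_dynEntourage.1 (hc (T^[j x] x)) (i - j x) (by omega)
    have hy := mem_dynEntourage.1 (hc (T^[j y] y)) (i - j x) (by omega)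
    rw [← hcc, ← hj] at hy
    rw [← Function.iterate_add_apply, Nat.sub_add_cancel h1] at hx hy
    exact hVU ⟨_, hx, hVs.symm _ _ hy⟩
  · exact hB ⟨hjB x (by omega) i h2, hjB y (by omega) i (by omega)⟩

/-- An image of the full shift on two symbols in which the zeroth symbol is visible at a fixed scale
gives entropy at least `log 2`: extending the words of length `n` by zeros gives `2 ^ n` points with
distinguishable orbit segments. -/
theorem log_two_le_coverEntropy_of_shift {X : Type*} [UniformSpace X] (T : X → X)
    (h : (ℤ → Fin 2) → X) (hT : ∀ s : ℤ → Fin 2, T (h s) = h (fun n => s (n + 1)))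
    (U : SetRel X X) (hU : U ∈ 𝓤 X)
    (hsep : ∀ s t : ℤ → Fin 2, s 0 ≠ t 0 → ∀ z, (h s, z) ∈ U → (h t, z) ∉ U) :
    ((Real.log 2 : ℝ) : EReal) ≤ coverEntropy T univ := by
  classical
  refine le_trans ?_ (netEntropyEntourage_le_coverEntropy T univ hU)
  have hit : ∀ (i : ℕ) (s : ℤ → Fin 2), T^[i] (h s) = h (fun n => s (n + i)) := by
    intro i
    induction i with
    | zero => intro s; simp
    | succ i ih =>
      intro s
      rw [Function.iterate_succ_apply, hT, ih]
      congr 1; ext n; push_cast; congr 2; ring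
  have hcard : ∀ n : ℕ, ((2 ^ n : ℕ) : ℕ∞) ≤ netMaxcard T univ U n := by
    intro n
    let e : (Fin n → Fin 2) → ℤ → Fin 2 := fun w k =>
      if hk : k.toNat < n then w ⟨k.toNat, hk⟩ else 0
    have key : ∀ w w' : Fin n → Fin 2, w ≠ w' →
        ∀ z, (h (e w), z) ∈ dynEntourage T U n → (h (e w'), z) ∉ dynEntourage T U n := by
      intro w w' hne z h1 h2
      obtain ⟨i, hi⟩ := Function.ne_iff.1 hne
      have h1' := mem_dynEntourage.1 h1 i i.2
      have h2' := mem_dynEntourage.1 h2 i i.2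
      rw [hit] at h1' h2'
      exact hsep _ _ (by simpa [e] using hi) _ h1' h2'
    have hrefl : ∀ x, (x, x) ∈ dynEntourage T U n := fun x =>
      mem_dynEntourage.2 fun _ _ => refl_mem_uniformity hU
    have hinj : Function.Injective fun w => h (e w) := by
      intro w w' hw
      by_contra hne
      refine key w w' hne (h (e w)) (hrefl _) ?_
      have hw' : h (e w) = h (e w') := hw
      rw [← hw']; exact hrefl _
    have hnet : IsDynNetIn T univ U n
        ((Finset.univ.image fun w => h (e w) : Finset X) : Set X) := by
      refine ⟨subset_univ _, ?_⟩
      intro x hx y hy hxy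
      simp only [Finset.coe_image, Finset.coe_univ, image_univ, mem_range] at hx hy
      obtain ⟨w, rfl⟩ := hx
      obtain ⟨w', rfl⟩ := hy
      refine Set.disjoint_left.2 fun z hz hz' => ?_
      exact key w w' (fun hww => hxy (by rw [hww])) z hz hz'
    have := hnet.card_le_netMaxcard
    rw [Finset.card_image_of_injective _ hinj] at this
    simpa using this
  have h2 : ((Real.log 2 : ℝ) : EReal) = ENNReal.log 2 := by
    rw [ENNReal.log_pos_real' (by norm_num)]; norm_num
  rw [h2, ← ExpGrowth.expGrowthSup_pow]
  refine ExpGrowth.expGrowthSup_monotone fun n => ?_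
  have := ENat.toENNReal_mono (hcard n)
  rw [ENat.toENNReal_coe] at this
  simpa using this

/-! ### The ball in coordinates -/

theorem mem_ball3_iff (p : E3) : p ∈ ball3 ↔ p 0 ^ 2 + p 1 ^ 2 + p 2 ^ 2 ≤ 1 := by
  rw [ball3, mem_closedBall_zero_iff, ← sq_le_one_iff₀ (norm_nonneg p),
    EuclideanSpace.norm_sq_eq, Fin.sum_univ_three]
  simp only [Real.norm_eq_abs, sq_abs]

theorem coord_two_mem {p : E3} (hp : p ∈ ball3) : p 2 ∈ Icc (-1 : ℝ) 1 := by
  rw [mem_ball3_iff] at hp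
  exact abs_le.1 ((sq_le_one_iff_abs_le_one _).1 (by nlinarith [sq_nonneg (p 0), sq_nonneg (p 1)]))

theorem height_mem (p : B3) : height p ∈ Icc (-1 : ℝ) 1 := coord_two_mem p.2

theorem continuous_height : Continuous height := by
  unfold height; fun_prop

@[simp] theorem height_northPole : height northPole = 1 := by simp [height, northPole]

@[simp] theorem height_southPole : height southPole = -1 := by simp [height, southPole]

theorem dist_northPole_le (p : B3) : dist p northPole ^ 2 ≤ 2 * (1 - height p) := by
  have hp := (mem_ball3_iff p).1 p.2
  rw [Subtype.dist_eq, dist_eq_norm, EuclideanSpace.norm_sq_eq, Fin.sum_univ_three]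
  simp [northPole, height]
  nlinarith

theorem dist_southPole_le (p : B3) : dist p southPole ^ 2 ≤ 2 * (1 + height p) := by
  have hp := (mem_ball3_iff p).1 p.2
  rw [Subtype.dist_eq, dist_eq_norm, EuclideanSpace.norm_sq_eq, Fin.sum_univ_three]
  simp [southPole, height]
  nlinarith

theorem eq_northPole_of_height {p : B3} (h : height p = 1) : p = northPole := by
  have := dist_northPole_le p
  rw [h] at this
  exact dist_eq_zero.1 (pow_eq_zero_iff two_ne_zero |>.1 (le_antisymm (by linarith) (sq_nonneg _)))

theorem eq_southPole_of_height {p : B3} (h : height p = -1) : p = southPole := by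
  have := dist_southPole_le p
  rw [h] at this
  exact dist_eq_zero.1 (pow_eq_zero_iff two_ne_zero |>.1 (le_antisymm (by linarith) (sq_nonneg _)))

theorem height_mem_Ioo {p : B3} (hN : p ≠ northPole) (hS : p ≠ southPole) :
    height p ∈ Ioo (-1 : ℝ) 1 :=
  ⟨lt_of_le_of_ne (height_mem p).1 fun h => hS (eq_southPole_of_height h.symm),
    lt_of_le_of_ne (height_mem p).2 fun h => hN (eq_northPole_of_height h)⟩

/-- Convergence to a pole is detected by the height. -/
theorem tendsto_southPole_of_height {ι : Type*} {l : Filter ι} {u : ι → B3}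
    (h : Tendsto (fun i => height (u i)) l (𝓝 (-1))) : Tendsto u l (𝓝 southPole) := by
  rw [tendsto_iff_dist_tendsto_zero]
  have h1 : Tendsto (fun i => dist (u i) southPole ^ 2) l (𝓝 0) := by
    refine squeeze_zero (fun _ => sq_nonneg _) (fun i => dist_southPole_le (u i)) ?_
    simpa using (h.const_add 1).const_mul 2
  simpa [Real.sqrt_sq dist_nonneg] using h1.sqrt

theorem tendsto_northPole_of_height {ι : Type*} {l : Filter ι} {u : ι → B3}
    (h : Tendsto (fun i => height (u i)) l (𝓝 1)) : Tendsto u l (𝓝 northPole) := by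
  rw [tendsto_iff_dist_tendsto_zero]
  have h1 : Tendsto (fun i => dist (u i) northPole ^ 2) l (𝓝 0) := by
    refine squeeze_zero (fun _ => sq_nonneg _) (fun i => dist_northPole_le (u i)) ?_
    simpa using (h.const_sub 1).const_mul 2
  simpa [Real.sqrt_sq dist_nonneg] using h1.sqrt

/-- A map `f` of `ℝ³` that is smooth on the ball, preserves it and has there a smooth inverse `g`,
restricted to a diffeomorphism of the ball. -/
def BallDiffeo.ofMaps (f g : E3 → E3) (hf : ContDiffOn ℝ ∞ f ball3) (hg : ContDiffOn ℝ ∞ g ball3)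
    (mf : MapsTo f ball3 ball3) (mg : MapsTo g ball3 ball3)
    (hgf : LeftInvOn g f ball3) (hfg : LeftInvOn f g ball3) : BallDiffeo where
  toEquiv :=
    { toFun := fun p => ⟨f p, mf p.2⟩
      invFun := fun p => ⟨g p, mg p.2⟩
      left_inv := fun p => Subtype.ext (hgf p.2)
      right_inv := fun p => Subtype.ext (hfg p.2) }
  smooth := hf.congr fun x hx => ambient_coe (fun p : B3 => (⟨f p, mf p.2⟩ : B3)) ⟨x, hx⟩
  smooth_symm := hg.congr fun x hx => ambient_coe (fun p : B3 => (⟨g p, mg p.2⟩ : B3)) ⟨x, hx⟩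

theorem BallDiffeo.continuous (f : BallDiffeo) : Continuous f := by
  have h : Continuous fun p : B3 => ambient f (p : E3) :=
    continuousOn_iff_continuous_domRestrict.1 (ContDiffOn.continuousOn f.smooth)
  simp only [ambient_coe] at h
  exact continuous_induced_rng.2 h

/-! ### Heights under a Lorentz boost -/

/-- The action of a Lorentz boost on heights, a one-parameter group of Möbius transformations
of `[-1, 1]` which fix the end points and move the other points downwards. -/
noncomputable def boostHeight (t z : ℝ) : ℝ :=
  (z * Real.cosh t - Real.sinh t) / (Real.cosh t - z * Real.sinh t)

theorem boost_denom_pos (t : ℝ) {z : ℝ} (hz : z ∈ Icc (-1 : ℝ) 1) :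
    0 < Real.cosh t - z * Real.sinh t := by
  have h1 := Real.exp_pos t
  have h2 := Real.exp_pos (-t)
  rw [Real.cosh_eq, Real.sinh_eq]
  obtain ⟨hz1, hz2⟩ := hz
  rcases hz1.eq_or_lt with h | h
  · rw [← h]; linarith
  · nlinarith [mul_nonneg (sub_nonneg.2 hz2) h1.le, mul_pos (by linarith : 0 < 1 + z) h2]

theorem boostHeight_zero (z : ℝ) : boostHeight 0 z = z := by simp [boostHeight]

@[simp] theorem boostHeight_one (t : ℝ) : boostHeight t 1 = 1 := by
  have := boost_denom_pos t (z := 1) (by norm_num)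
  rw [one_mul] at this
  rw [boostHeight, one_mul, one_mul, div_self this.ne']

theorem boostHeight_neg (t z : ℝ) : boostHeight (-t) z = -boostHeight t (-z) := by
  simp only [boostHeight, Real.cosh_neg, Real.sinh_neg]
  rw [← neg_div]; congr 1 <;> ring

@[simp] theorem boostHeight_neg_one (t : ℝ) : boostHeight t (-1) = -1 := by
  have := boostHeight_neg (-t) (-1)
  simpa using this

theorem boostHeight_sub (t : ℝ) {z w : ℝ} (hz : z ∈ Icc (-1 : ℝ) 1) (hw : w ∈ Icc (-1 : ℝ) 1) :
    boostHeight t w - boostHeight t z =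
      (w - z) / ((Real.cosh t - w * Real.sinh t) * (Real.cosh t - z * Real.sinh t)) := by
  have h1 := (boost_denom_pos t hz).ne'
  have h2 := (boost_denom_pos t hw).ne'
  rw [boostHeight, boostHeight, div_sub_div _ _ h2 h1]
  congr 1
  linear_combination (w - z) * Real.cosh_sq t

theorem boostHeight_strictMonoOn (t : ℝ) : StrictMonoOn (boostHeight t) (Icc (-1) 1) := by
  intro z hz w hw hzw
  have h := boostHeight_sub t hz hw
  have : 0 < boostHeight t w - boostHeight t z := by
    rw [h]
    exact div_pos (sub_pos.2 hzw) (mul_pos (boost_denom_pos t hw) (boost_denom_pos t hz))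
  linarith

theorem boostHeight_mem (t : ℝ) {z : ℝ} (hz : z ∈ Icc (-1 : ℝ) 1) :
    boostHeight t z ∈ Icc (-1 : ℝ) 1 := by
  have h := (boostHeight_strictMonoOn t).monotoneOn
  have h1 := h (a := -1) (by norm_num) hz hz.1
  have h2 := h (b := 1) hz (by norm_num) hz.2
  rw [boostHeight_neg_one] at h1
  rw [boostHeight_one] at h2
  exact ⟨h1, h2⟩

theorem boostHeight_mem_Ioo (t : ℝ) {z : ℝ} (hz : z ∈ Ioo (-1 : ℝ) 1) :
    boostHeight t z ∈ Ioo (-1 : ℝ) 1 := by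
  have h := boostHeight_strictMonoOn t
  have h1 := h (a := -1) (by norm_num) (Ioo_subset_Icc_self hz) hz.1
  have h2 := h (b := 1) (Ioo_subset_Icc_self hz) (by norm_num) hz.2
  rw [boostHeight_neg_one] at h1
  rw [boostHeight_one] at h2
  exact ⟨h1, h2⟩

/-- Cocycle identity for the denominators of the boosts. -/
theorem boost_denom_add (s t : ℝ) {z : ℝ} (hz : z ∈ Icc (-1 : ℝ) 1) :
    Real.cosh s - boostHeight t z * Real.sinh s =
      (Real.cosh (s + t) - z * Real.sinh (s + t)) / (Real.cosh t - z * Real.sinh t) := by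
  have h := (boost_denom_pos t hz).ne'
  rw [boostHeight, Real.cosh_add, Real.sinh_add]
  field_simp
  ring

theorem boostHeight_add (s t : ℝ) {z : ℝ} (hz : z ∈ Icc (-1 : ℝ) 1) :
    boostHeight (s + t) z = boostHeight s (boostHeight t z) := by
  have h := (boost_denom_pos t hz).ne'
  have h' := (boost_denom_pos (s + t) hz).ne'
  rw [boostHeight, boostHeight, boost_denom_add s t hz, div_div_eq_mul_div]
  congr 1
  rw [boostHeight, Real.cosh_add, Real.sinh_add]
  field_simp
  ring

theorem boostHeight_lt {t z : ℝ} (ht : 0 < t) (hz : z ∈ Ioo (-1 : ℝ) 1) : boostHeight t z < z := by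
  rw [boostHeight, div_lt_iff₀ (boost_denom_pos t (Ioo_subset_Icc_self hz))]
  have h1 := Real.sinh_pos_iff.2 ht
  nlinarith [mul_pos h1 (mul_pos (by linarith [hz.1] : 0 < 1 + z) (by linarith [hz.2] : 0 < 1 - z))]

theorem boostHeight_le {t z : ℝ} (ht : 0 ≤ t) (hz : z ∈ Icc (-1 : ℝ) 1) : boostHeight t z ≤ z := by
  rw [boostHeight, div_le_iff₀ (boost_denom_pos t hz)]
  have h1 := Real.sinh_nonneg_iff.2 ht
  nlinarith [mul_nonneg h1
    (mul_nonneg (by linarith [hz.1] : 0 ≤ 1 + z) (by linarith [hz.2] : 0 ≤ 1 - z))]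

theorem tendsto_boostHeight_atTop {z : ℝ} (hz : z ∈ Ico (-1 : ℝ) 1) :
    Tendsto (fun t => boostHeight t z) atTop (𝓝 (-1)) := by
  have hz' : z ∈ Icc (-1 : ℝ) 1 := Ico_subset_Icc_self hz
  have h1z : 0 < 1 - z := by linarith [hz.2]
  have hlim : Tendsto (fun t : ℝ => 4 / (1 - z) * Real.exp (-t)) atTop (𝓝 0) := by
    simpa using (Real.tendsto_exp_neg_atTop_nhds_zero).const_mul (4 / (1 - z))
  have key : Tendsto (fun t => boostHeight t z + 1) atTop (𝓝 0) := by
    refine squeeze_zero' (Eventually.of_forall fun t => by linarith [(boostHeight_mem t hz').1])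
      ?_ hlim
    filter_upwards [eventually_ge_atTop 0] with t ht
    have hD := boost_denom_pos t hz'
    have e1 := Real.exp_pos t
    have e2 := Real.exp_pos (-t)
    have e3 : 1 ≤ Real.exp t := Real.one_le_exp ht
    have e : boostHeight t z + 1 =
        (1 + z) * Real.exp (-t) / (Real.cosh t - z * Real.sinh t) := by
      rw [boostHeight, div_add_one hD.ne', Real.cosh_eq, Real.sinh_eq]; congr 1; ring
    have hDge : (1 - z) / 2 ≤ Real.cosh t - z * Real.sinh t := by
      rw [Real.cosh_eq, Real.sinh_eq]
      nlinarith [mul_nonneg h1z.le (sub_nonneg.2 e3),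
        mul_nonneg (by linarith [hz.1] : 0 ≤ 1 + z) e2.le]
    rw [e]
    calc (1 + z) * Real.exp (-t) / (Real.cosh t - z * Real.sinh t)
        ≤ 2 * Real.exp (-t) / ((1 - z) / 2) := by
          gcongr; linarith [hz.2]
      _ = _ := by field_simp; ring
  simpa using key.sub_const 1

theorem tendsto_boostHeight_atBot {z : ℝ} (hz : z ∈ Ioc (-1 : ℝ) 1) :
    Tendsto (fun t => boostHeight t z) atBot (𝓝 1) := by
  have h := ((tendsto_boostHeight_atTop (z := -z) ⟨by linarith [hz.2], by linarith [hz.1]⟩).comp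
    tendsto_neg_atBot_atTop).neg
  rw [neg_neg] at h
  refine h.congr fun t => ?_
  rw [Function.comp_apply, ← boostHeight_neg, neg_neg]

/-! ### Maps which act on heights as a boost -/

theorem height_iterate {T : B3 → B3} {τ : ℝ} (hT : ∀ p, height (T p) = boostHeight τ (height p))
    (n : ℕ) (p : B3) : height (T^[n] p) = boostHeight (n * τ) (height p) := by
  induction n with
  | zero => simp [boostHeight_zero]
  | succ n ih =>
    rw [Function.iterate_succ_apply', hT, ih, ← boostHeight_add _ _ (height_mem p)]
    congr 1; push_cast; ring

/-- Strictly decreasing heights confine the nonwandering set to the poles. -/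
theorem nonwanderingSet_eq_poles {T : B3 → B3} {τ : ℝ} (hτ : 0 < τ)
    (hT : ∀ p, height (T p) = boostHeight τ (height p)) :
    nonwanderingSet T = {northPole, southPole} := by
  ext p
  simp only [mem_insert_iff, mem_singleton_iff]
  constructor
  · intro hp
    by_contra hne
    push Not at hne
    have hz := height_mem_Ioo hne.1 hne.2
    set z := height p with hzdef
    -- `c` lies strictly between `z` and its preimage `w`, so that `boostHeight τ c < z < c`
    set w := boostHeight (-τ) z with hwdef
    have hw : w ∈ Ioo (-1 : ℝ) 1 := boostHeight_mem_Ioo _ hz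
    have hbw : boostHeight τ w = z := by
      rw [hwdef, ← boostHeight_add _ _ (Ioo_subset_Icc_self hz), add_neg_cancel, boostHeight_zero]
    have hzw : z < w := by
      have := boostHeight_lt hτ hw
      rwa [hbw] at this
    set c := (z + w) / 2 with hc
    have hzc : z < c := by linarith
    have hcw : c < w := by linarith
    have hcI : c ∈ Icc (-1 : ℝ) 1 := ⟨by linarith [hz.1], by linarith [hw.2]⟩
    have hbc : boostHeight τ c < z := by
      rw [← hbw]; exact boostHeight_strictMonoOn τ hcI (Ioo_subset_Icc_self hw) hcw
    obtain ⟨n, hn, q, ⟨q', hq', rfl⟩, hq⟩ := hp (height ⁻¹' Ioo (boostHeight τ c) c)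
      (continuous_height.continuousAt (isOpen_Ioo.mem_nhds ⟨hbc, hzc⟩))
    have h1 : height (T^[n] q') ≤ boostHeight τ (height q') := by
      rw [height_iterate hT]
      have : (n : ℝ) * τ = (n - 1) * τ + τ := by ring
      rw [this, boostHeight_add _ _ (height_mem q')]
      refine boostHeight_le (mul_nonneg ?_ hτ.le) (boostHeight_mem _ (height_mem q'))
      have : (1 : ℝ) ≤ n := by exact_mod_cast hn
      linarith
    have h2 : boostHeight τ (height q') < boostHeight τ c :=
      boostHeight_strictMonoOn τ (height_mem q') hcI hq'.2
    exact absurd hq.1 (not_lt.2 (h1.trans h2.le))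
  · have hfix : ∀ q : B3, T q = q → q ∈ nonwanderingSet T := fun q hq U hU =>
      ⟨1, le_rfl, q, ⟨q, mem_of_mem_nhds hU, by simpa using hq⟩, mem_of_mem_nhds hU⟩
    rintro (rfl | rfl)
    · exact hfix _ (eq_northPole_of_height (by rw [hT]; simp))
    · exact hfix _ (eq_southPole_of_height (by rw [hT]; simp))

/-- Entropy vanishes: orbits only transit from a small cap at the north pole to one at the south
pole. -/
theorem coverEntropy_eq_zero_of_boost {T : B3 → B3} {τ : ℝ} (hτ : 0 < τ)
    (hT : ∀ p, height (T p) = boostHeight τ (height p)) :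
    coverEntropy T univ = 0 := by
  have : CompactSpace B3 := isCompact_iff_compactSpace.1 (isCompact_closedBall _ _)
  refine le_antisymm (coverEntropy_nonpos_of_transit T fun U hU => ?_)
    (coverEntropy_nonneg T ⟨northPole, mem_univ _⟩)
  obtain ⟨ε, hε, hεU⟩ := Metric.mem_uniformity_dist.1 hU
  -- a cap of height `δ` has diameter at most `2 √(2δ) ≤ ε / 2`
  set δ : ℝ := min (ε ^ 2 / 32) 1 with hδ
  have hδ0 : 0 < δ := lt_min (by positivity) one_pos
  have hδ1 : δ ≤ 1 := min_le_right _ _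
  have hδε : δ ≤ ε ^ 2 / 32 := min_le_left _ _
  have hcap : ∀ (P : B3) {x y : B3}, dist x P ^ 2 ≤ 2 * δ → dist y P ^ 2 ≤ 2 * δ →
      (x, y) ∈ U := by
    intro P x y hx hy
    refine hεU ?_
    have hx' : dist x P ≤ ε / 4 := abs_le_of_sq_le_sq' (by nlinarith) (by positivity) |>.2
    have hy' : dist y P ≤ ε / 4 := abs_le_of_sq_le_sq' (by nlinarith) (by positivity) |>.2
    linarith [dist_triangle_right x y P]
  refine ⟨{p | 1 - δ < height p}, {p | height p < -1 + δ}, ?_, ?_, ?_⟩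
  · rintro ⟨x, y⟩ ⟨hx, hy⟩
    simp only [mem_ofPred] at hx hy
    exact hcap northPole ((dist_northPole_le x).trans (by linarith))
      ((dist_northPole_le y).trans (by linarith))
  · rintro ⟨x, y⟩ ⟨hx, hy⟩
    simp only [mem_ofPred] at hx hy
    exact hcap southPole ((dist_southPole_le x).trans (by linarith))
      ((dist_southPole_le y).trans (by linarith))
  · have hlim : Tendsto (fun n : ℕ => boostHeight (n * τ) (1 - δ)) atTop (𝓝 (-1)) :=
      (tendsto_boostHeight_atTop ⟨by linarith, by linarith⟩).comp
        (tendsto_natCast_atTop_atTop.atTop_mul_const hτ)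
    obtain ⟨M, hM⟩ := eventually_atTop.1
      (hlim.eventually (gt_mem_nhds (by linarith : (-1 : ℝ) < -1 + δ)))
    refine ⟨M, fun x hx i hi => ?_⟩
    simp only [mem_ofPred, not_lt] at hx ⊢
    rw [height_iterate hT]
    exact ((boostHeight_strictMonoOn _).monotoneOn (height_mem x)
      ⟨by linarith, by linarith⟩ hx).trans_lt (hM i hi)

/-! ### The north-south flow of Lorentz boosts -/

/-- The Lorentz boost along the vertical axis, in the projective (Klein) model of the ball. -/
noncomputable def boost (t : ℝ) (p : E3) : E3 :=
  (Real.cosh t - p 2 * Real.sinh t)⁻¹ • !₂[p 0, p 1, p 2 * Real.cosh t - Real.sinh t]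

@[simp] theorem boost_apply_zero (t : ℝ) (p : E3) :
    boost t p 0 = p 0 / (Real.cosh t - p 2 * Real.sinh t) := by
  simp [boost, div_eq_inv_mul]

@[simp] theorem boost_apply_one (t : ℝ) (p : E3) :
    boost t p 1 = p 1 / (Real.cosh t - p 2 * Real.sinh t) := by
  simp [boost, div_eq_inv_mul]

@[simp] theorem boost_apply_two (t : ℝ) (p : E3) : boost t p 2 = boostHeight t (p 2) := by
  simp [boost, boostHeight, div_eq_inv_mul]

theorem boost_zero (p : E3) : boost 0 p = p := by
  ext i; fin_cases i <;> simp [boostHeight_zero]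

theorem boost_mem (t : ℝ) {p : E3} (hp : p ∈ ball3) : boost t p ∈ ball3 := by
  have hD := boost_denom_pos t (coord_two_mem hp)
  rw [mem_ball3_iff] at hp ⊢
  rw [boost_apply_zero, boost_apply_one, boost_apply_two, boostHeight, div_pow, div_pow, div_pow,
    ← add_div, ← add_div, div_le_one (by positivity)]
  nlinarith [Real.cosh_sq t]

theorem boost_add (s t : ℝ) {p : E3} (hp : p ∈ ball3) :
    boost (s + t) p = boost s (boost t p) := by
  have hz := coord_two_mem hp
  have h := (boost_denom_pos t hz).ne'
  have h' := (boost_denom_pos (s + t) hz).ne'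
  ext i
  fin_cases i
  · simp only [Fin.zero_eta, boost_apply_zero, boost_apply_two, boost_denom_add s t hz]
    field_simp
  · simp only [Fin.mk_one, boost_apply_one, boost_apply_two, boost_denom_add s t hz]
    field_simp
  · simpa using boostHeight_add s t hz

theorem contDiffOn_boost :
    ContDiffOn ℝ ∞ (fun q : ℝ × E3 => boost q.1 q.2) (univ ×ˢ ball3) := by
  have hc : ∀ i : Fin 3, ContDiff ℝ ∞ fun q : ℝ × E3 => q.2 i := fun i =>
    contDiff_euclidean.1 contDiff_snd i
  have hch : ContDiff ℝ ∞ fun q : ℝ × E3 => Real.cosh q.1 := Real.contDiff_cosh.comp contDiff_fst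
  have hsh : ContDiff ℝ ∞ fun q : ℝ × E3 => Real.sinh q.1 := Real.contDiff_sinh.comp contDiff_fst
  have hD : ContDiffOn ℝ ∞
      (fun q : ℝ × E3 => Real.cosh q.1 - q.2 2 * Real.sinh q.1) (univ ×ˢ ball3) :=
    (hch.sub ((hc 2).mul hsh)).contDiffOn
  refine (hD.inv fun q hq => (boost_denom_pos _ (coord_two_mem hq.2)).ne').smul ?_
  refine (contDiff_euclidean.2 fun i => ?_).contDiffOn
  fin_cases i
  · exact hc 0
  · exact hc 1
  · exact ((hc 2).mul hch).sub hsh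

theorem contDiffOn_boost_right (t : ℝ) : ContDiffOn ℝ ∞ (boost t) ball3 := by
  have h : ContDiffOn ℝ ∞ (fun p : E3 => (t, p)) ball3 :=
    (contDiff_const.prodMk contDiff_id).contDiffOn
  have hm : MapsTo (fun p : E3 => (t, p)) ball3 (univ ×ˢ ball3) := fun _ hp => ⟨mem_univ _, hp⟩
  have h2 := contDiffOn_boost.comp h hm
  exact h2

/-- The boosts as diffeomorphisms of the ball. -/
noncomputable def boostFlow (t : ℝ) : BallDiffeo :=
  BallDiffeo.ofMaps (boost t) (boost (-t)) (contDiffOn_boost_right t) (contDiffOn_boost_right (-t))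
    (fun _ => boost_mem t) (fun _ => boost_mem (-t))
    (fun p hp => by rw [← boost_add _ _ hp, neg_add_cancel, boost_zero])
    (fun p hp => by rw [← boost_add _ _ hp, add_neg_cancel, boost_zero])

@[simp] theorem coe_boostFlow (t : ℝ) (p : B3) : (boostFlow t p : E3) = boost t p := rfl

theorem height_boostFlow (t : ℝ) (p : B3) :
    height (boostFlow t p) = boostHeight t (height p) := by
  simp [height]

theorem boostFlow_add (s t : ℝ) (p : B3) : boostFlow (s + t) p = boostFlow s (boostFlow t p) :=
  Subtype.ext (boost_add s t p.2)

theorem boostFlow_zero (p : B3) : boostFlow 0 p = p := Subtype.ext (boost_zero p)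

/-- The limit set of a convergent orbit is its limit. -/
theorem omegaLimit_singleton_eq_of_tendsto {ι X : Type*} [TopologicalSpace X] [T2Space X]
    {l : Filter ι} [l.NeBot] {φ : ι → X → X} {p q : X} (h : Tendsto (fun t => φ t p) l (𝓝 q)) :
    omegaLimit l φ {p} = {q} := by
  ext y
  rw [mem_omegaLimit_singleton_iff_mapClusterPt, mem_singleton_iff]
  constructor
  · intro hy
    have : (𝓝 y ⊓ 𝓝 q).NeBot := ClusterPt.mono hy h
    exact eq_of_nhds_neBot this
  · rintro rfl
    exact h.mapClusterPt

theorem isNorthSouthFlow_boostFlow : IsNorthSouthFlow boostFlow where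
  map_zero := boostFlow_zero
  map_add := boostFlow_add
  smooth := contDiffOn_boost.congr fun q hq => ambient_coe (boostFlow q.1) ⟨q.2, hq.2⟩
  singularity_iff p := by
    constructor
    · intro h
      by_contra hne
      push Not at hne
      have h1 := congrArg height (h 1)
      rw [height_boostFlow] at h1
      exact (boostHeight_lt one_pos (height_mem_Ioo hne.1 hne.2)).ne h1
    · rintro (rfl | rfl) t
      · exact eq_northPole_of_height (by rw [height_boostFlow]; simp)
      · exact eq_southPole_of_height (by rw [height_boostFlow]; simp)
  alpha_limit p hN hS := by
    refine omegaLimit_singleton_eq_of_tendsto (tendsto_northPole_of_height ?_)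
    simp only [height_boostFlow]
    exact tendsto_boostHeight_atBot (Ioo_subset_Ioc_self (height_mem_Ioo hN hS))
  omega_limit p hN hS := by
    refine omegaLimit_singleton_eq_of_tendsto (tendsto_southPole_of_height ?_)
    simp only [height_boostFlow]
    exact tendsto_boostHeight_atTop (Ioo_subset_Ico_self (height_mem_Ioo hN hS))
  slice_lower τ hτ c hc := by
    refine ⟨boostHeight τ c, boostHeight_mem_Ioo τ hc, boostHeight_lt hτ hc, ?_⟩
    ext q
    constructor
    · rintro ⟨p, hp, rfl⟩
      have hp : height p = c := hp
      exact (height_boostFlow τ p).trans (by rw [hp])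
    · intro hq
      have hq : height q = boostHeight τ c := hq
      refine ⟨boostFlow (-τ) q, ?_, ?_⟩
      · show height _ = c
        rw [height_boostFlow, hq, ← boostHeight_add _ _ (Ioo_subset_Icc_self hc), neg_add_cancel,
          boostHeight_zero]
      · rw [← boostFlow_add, add_neg_cancel, boostFlow_zero]

/-! ### Smooth families are continuous in the `C^∞` topology -/

theorem uniqueDiffOn_ball3 : UniqueDiffOn ℝ ball3 :=
  uniqueDiffOn_convex (convex_closedBall _ _) ⟨0, by
    rw [ball3, interior_closedBall _ one_ne_zero]; simp⟩

open scoped Pointwise in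
/-- The derivatives in the space variable of a jointly smooth family are jointly continuous. -/
theorem continuousOn_iteratedFDerivWithin_family {E F : Type*} [NormedAddCommGroup E]
    [NormedSpace ℝ E] [NormedAddCommGroup F] [NormedSpace ℝ F] {s : Set E} (hs : UniqueDiffOn ℝ s)
    {H : ℝ × E → F} (hH : ContDiffOn ℝ ∞ H (univ ×ˢ s)) (k : ℕ) :
    ContinuousOn (fun q : ℝ × E => iteratedFDerivWithin ℝ k (fun x => H (q.1, x)) s q.2)
      (univ ×ˢ s) := by
  have hu : UniqueDiffOn ℝ ((univ : Set ℝ) ×ˢ s) := uniqueDiffOn_univ.prod hs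
  -- `H (t, ·)` is `H` after a translation by `(t, 0)` and the inclusion of the second factor
  have key : ∀ q ∈ (univ : Set ℝ) ×ˢ s,
      iteratedFDerivWithin ℝ k (fun x => H (q.1, x)) s q.2 =
        (iteratedFDerivWithin ℝ k H (univ ×ˢ s) q).compContinuousLinearMap
          fun _ => ContinuousLinearMap.inr ℝ ℝ E := by
    rintro ⟨t, x⟩ ⟨-, hx⟩
    have hpre : (ContinuousLinearMap.inr ℝ ℝ E) ⁻¹' ((univ : Set ℝ) ×ˢ s) = s := by
      ext y; simp
    have hshift : ContDiffOn ℝ ∞ (fun q : ℝ × E => H ((t, 0) + q)) (univ ×ˢ s) :=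
      hH.comp (contDiff_const.add contDiff_id).contDiffOn fun q hq => by
        simpa using hq.2
    have h1 := (ContinuousLinearMap.inr ℝ ℝ E).iteratedFDerivWithin_comp_right hshift hu
      (by rw [hpre]; exact hs) (x := x) (by simpa using hx) (i := k) (by exact_mod_cast le_top)
    have hvadd : ((t, (0 : E)) : ℝ × E) +ᵥ ((univ : Set ℝ) ×ˢ s) = univ ×ˢ s := by
      ext ⟨a, y⟩
      rw [mem_vadd_set_iff_neg_vadd_mem]
      simp
    rw [iteratedFDerivWithin_comp_add_left, hvadd, hpre] at h1
    simpa [Function.comp_def] using h1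
  refine ContinuousOn.congr ?_ key
  exact (ContinuousMultilinearMap.compContinuousLinearMapL
    fun _ : Fin k => ContinuousLinearMap.inr ℝ ℝ E).continuous.comp_continuousOn
      (hH.continuousOn_iteratedFDerivWithin (by exact_mod_cast le_top) hu)

/-- A jointly smooth one-parameter family of diffeomorphisms of the ball is continuous. -/
theorem tendsto_of_smooth_family {g : ℝ → BallDiffeo}
    (hg : ContDiffOn ℝ ∞ (fun q : ℝ × E3 => ambient (g q.1) q.2) (univ ×ˢ ball3)) (t : ℝ) :
    Tendsto g (𝓝 t) (𝓝 (g t)) := by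
  have : CompactSpace B3 := isCompact_iff_compactSpace.1 (isCompact_closedBall _ _)
  rw [nhds_induced, tendsto_comap_iff, tendsto_pi_nhds]
  intro k
  rw [UniformFun.tendsto_iff_tendstoUniformly]
  refine ContinuousOn.tendstoUniformly (f := fun (τ : ℝ) (p : B3) =>
    iteratedFDerivWithin ℝ k (ambient (g τ)) ball3 (p : E3)) (x := t) univ_mem ?_
  refine (continuousOn_iteratedFDerivWithin_family uniqueDiffOn_ball3 hg k).comp
    (f := fun q : ℝ × B3 => (q.1, (q.2 : E3))) (by fun_prop) fun q _ => ⟨mem_univ _, q.2.2⟩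

/-- A smooth family of diffeomorphisms stays smooth after precomposition. -/
theorem smooth_family_comp {φ : ℝ → BallDiffeo}
    (hφ : ContDiffOn ℝ ∞ (fun q : ℝ × E3 => ambient (φ q.1) q.2) (univ ×ˢ ball3))
    (F : BallDiffeo) :
    ContDiffOn ℝ ∞ (fun q : ℝ × E3 => ambient ((φ q.1).comp F) q.2) (univ ×ˢ ball3) := by
  have hF : ContDiffOn ℝ ∞ (fun q : ℝ × E3 => (q.1, ambient F q.2)) (univ ×ˢ ball3) :=
    contDiff_fst.contDiffOn.prodMk
      (ContDiffOn.comp (show ContDiffOn ℝ ∞ (ambient F) ball3 from F.smooth)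
        contDiff_snd.contDiffOn fun q hq => hq.2)
  exact (hφ.comp hF fun q hq => ⟨mem_univ _, ambient_mapsTo F hq.2⟩).congr fun q hq =>
    ambient_comp (φ q.1) F hq.2

theorem tendsto_flow_comp {φ : ℝ → BallDiffeo} (hφ : IsNorthSouthFlow φ) (F : BallDiffeo) :
    Tendsto (fun τ => (φ τ).comp F) (𝓝[>] 0) (𝓝 F) := by
  have h0 : (φ 0).comp F = F := by
    have h : (φ 0).toEquiv = Equiv.refl B3 := Equiv.ext hφ.map_zero
    rcases F with ⟨e, h1, h2⟩
    simp only [BallDiffeo.comp, h, Equiv.trans_refl]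
  have h := tendsto_of_smooth_family (g := fun τ => (φ τ).comp F)
    (smooth_family_comp hφ.smooth F) 0
  rw [h0] at h
  exact h.mono_left nhdsWithin_le_nhds

/-! ### A compactly supported shear -/

/-- A smooth perturbation of the identity with Lipschitz constant less than one is a
diffeomorphism. -/
theorem exists_diffeo_of_lipschitz_perturbation {E : Type*} [NormedAddCommGroup E]
    [NormedSpace ℝ E] [CompleteSpace E] {G : E → E} (hG : ContDiff ℝ ∞ G) {c : NNReal}
    (hc : c < 1) (hL : LipschitzWith c G) :
    ∃ e : E ≃ E, (∀ x, e x = x + G x) ∧ ContDiff ℝ ∞ e ∧ ContDiff ℝ ∞ e.symm := by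
  have happ : ApproximatesLinearOn (fun x => x + G x)
      ((ContinuousLinearEquiv.refl ℝ E : E ≃L[ℝ] E) : E →L[ℝ] E) univ c := by
    intro x _ y _
    have := hL.dist_le_mul x y
    rw [dist_eq_norm, dist_eq_norm] at this
    simpa [add_sub_add_comm] using this
  have hcN : Subsingleton E ∨ c < ‖((ContinuousLinearEquiv.refl ℝ E).symm : E →L[ℝ] E)‖₊⁻¹ := by
    rcases subsingleton_or_nontrivial E with h | h
    · exact Or.inl h
    · right
      have h1 : ‖((ContinuousLinearEquiv.refl ℝ E).symm : E →L[ℝ] E)‖₊ = 1 := by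
        have : ((ContinuousLinearEquiv.refl ℝ E).symm : E →L[ℝ] E) = ContinuousLinearMap.id ℝ E :=
          rfl
        rw [this]
        exact NNReal.eq ContinuousLinearMap.norm_id
      rw [h1, inv_one]; exact hc
  let e : E ≃ₜ E := happ.toHomeomorph (fun x => x + G x) hcN
  have he : ∀ x, e x = x + G x := fun x => rfl
  have hsm : ContDiff ℝ ∞ (e : E → E) := contDiff_id.add hG
  have hnorm : ∀ a, ‖-fderiv ℝ G a‖ < 1 := fun a => by
    rw [norm_neg]
    exact (norm_fderiv_le_of_lipschitz ℝ hL).trans_lt (by exact_mod_cast hc)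
  have hder : ∀ a, HasFDerivAt e
      ((ContinuousLinearEquiv.unitsEquiv ℝ E (Units.oneSub (-fderiv ℝ G a) (hnorm a)) :
        E ≃L[ℝ] E) : E →L[ℝ] E) a := by
    intro a
    have h1 : HasFDerivAt e (ContinuousLinearMap.id ℝ E + fderiv ℝ G a) a :=
      (hasFDerivAt_id a).add ((hG.differentiable (by simp)) a).hasFDerivAt
    convert h1 using 1
    ext v
    simp [ContinuousLinearEquiv.unitsEquiv_apply]
  exact ⟨e.toEquiv, he, hsm, e.contDiff_symm hder hsm⟩

/-- A smooth function with two expanding affine branches, `17 / 4 * x` on `x ≤ 2 / 3` and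
`17 / 4 * x - 15 / 4` on `1 ≤ x`; its values in between do not matter. -/
noncomputable def foldFun (x : ℝ) : ℝ := 17 / 4 * x - 15 / 4 * Real.smoothTransition (3 * x - 2)

theorem contDiff_foldFun : ContDiff ℝ ∞ foldFun := by
  have h : ContDiff ℝ ∞ fun x : ℝ => Real.smoothTransition (3 * x - 2) :=
    Real.smoothTransition.contDiff.comp (by fun_prop)
  unfold foldFun
  fun_prop

/-- A smooth compactly supported displacement is realised by a diffeomorphism after division by a
large integer. -/
theorem exists_diffeo_of_compact_support {E : Type*} [NormedAddCommGroup E] [NormedSpace ℝ E]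
    [CompleteSpace E] {G : E → E} (hG : ContDiff ℝ ∞ G) (hGc : HasCompactSupport G) :
    ∃ (N : ℕ) (e : Equiv.Perm E), 0 < N ∧ (∀ x, e x = x + (N : ℝ)⁻¹ • G x) ∧
      ContDiff ℝ ∞ e ∧ ContDiff ℝ ∞ e.symm := by
  obtain ⟨K, hK⟩ := ContDiff.lipschitzWith_of_hasCompactSupport hGc hG (by simp)
  obtain ⟨N, hN⟩ := exists_nat_gt K
  have hN0 : (0 : NNReal) < N := lt_of_le_of_lt zero_le hN
  have hL : LipschitzWith (‖(N : ℝ)⁻¹‖₊ * K) fun p => (N : ℝ)⁻¹ • G p :=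
    (lipschitzWith_smul _).comp hK
  have hc : ‖(N : ℝ)⁻¹‖₊ * K < 1 := by
    rw [nnnorm_inv, Real.nnnorm_natCast, inv_mul_lt_iff₀ hN0, mul_one]
    exact hN
  obtain ⟨e, he⟩ := exists_diffeo_of_lipschitz_perturbation (contDiff_const.smul hG) hc hL
  exact ⟨N, e, by exact_mod_cast hN0, he⟩

theorem contDiff_iterate {E : Type*} [NormedAddCommGroup E] [NormedSpace ℝ E] {f : E → E}
    (hf : ContDiff ℝ ∞ f) (n : ℕ) : ContDiff ℝ ∞ f^[n] := by
  induction n with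
  | zero => exact contDiff_id
  | succ n ih => exact ih.comp hf

/-- If the displacement `G` is constantly `w` on the segment from `x` to `x + w`, then `N` steps of
size `1 / N` along `G` lead from `x` to `x + w`. -/
theorem iterate_eq_add_of_segment {E : Type*} [AddCommGroup E] [Module ℝ E] {G e : E → E}
    {N : ℕ} (hN : 0 < N) (he : ∀ x, e x = x + (N : ℝ)⁻¹ • G x) {x w : E}
    (hG : ∀ c ∈ Icc (0 : ℝ) 1, G (x + c • w) = w) : e^[N] x = x + w := by
  have hNR : (0 : ℝ) < N := by exact_mod_cast hN
  have hk : ∀ k : ℕ, k ≤ N → e^[k] x = x + ((k : ℝ) / N) • w := by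
    intro k
    induction k with
    | zero => intro _; simp
    | succ k ih =>
      intro hkN
      have hk1 : (k : ℝ) / N ≤ 1 := by
        rw [div_le_one hNR]; exact_mod_cast (Nat.le_succ k).trans hkN
      rw [Function.iterate_succ_apply', ih ((Nat.le_succ k).trans hkN), he,
        hG _ ⟨by positivity, hk1⟩, add_assoc, ← add_smul]
      congr 2
      push_cast
      rw [← one_div]; ring
  rw [hk N le_rfl, div_self hNR.ne', one_smul]

/-- The displacement of the shear `(x, y, z) ↦ (x, y + foldFun (10 x) / 10, z)`. -/
noncomputable def shearVector (p : E3) : E3 := EuclideanSpace.single 1 (foldFun (10 * p 0) / 10)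

theorem contDiff_shearVector : ContDiff ℝ ∞ shearVector := by
  have h0 : ContDiff ℝ ∞ fun p : E3 => p 0 := contDiff_euclidean.1 contDiff_id 0
  have h1 : ContDiff ℝ ∞ fun p : E3 => foldFun (10 * p 0) / 10 :=
    (contDiff_foldFun.comp (contDiff_const.mul h0)).div_const _
  refine contDiff_euclidean.2 fun i => ?_
  by_cases hi : i = 1
  · subst hi; simpa [shearVector] using h1
  · simpa [shearVector, hi] using contDiff_const

theorem shearVector_add_smul (p : E3) (c : ℝ) :
    shearVector (p + c • shearVector p) = shearVector p := by
  simp [shearVector]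

/-- A compactly supported diffeomorphism of `ℝ³` acting near the origin as the shear
`(x, y, z) ↦ (x, y + foldFun (10 x) / 10, z)`. The cut-off shear is too strong to be a small
perturbation of the identity, so it is composed of many weak ones. -/
theorem exists_shear : ∃ e : E3 ≃ E3, ContDiff ℝ ∞ e ∧ ContDiff ℝ ∞ e.symm ∧
    (∀ p, e p 2 = p 2) ∧ (∀ p, 1 ≤ ‖p‖ → e p = p) ∧
    ∀ p, ‖p‖ ≤ 1 / 2 → ‖p + shearVector p‖ ≤ 1 / 2 → e p = p + shearVector p := by
  obtain ⟨χ, hχs, hχc, hχ1, hχ0⟩ : ∃ χ : E3 → ℝ, ContDiff ℝ ∞ χ ∧ HasCompactSupport χ ∧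
      (∀ p, ‖p‖ ≤ 1 / 2 → χ p = 1) ∧ ∀ p, 1 ≤ ‖p‖ → χ p = 0 := by
    let χ : ContDiffBump (0 : E3) := ⟨1 / 2, 1, by norm_num, by norm_num⟩
    exact ⟨χ, χ.contDiff, χ.hasCompactSupport,
      fun p hp => χ.one_of_mem_closedBall (mem_closedBall_zero_iff.2 hp),
      fun p hp => χ.zero_of_le_dist (by rw [dist_zero_right]; exact hp)⟩
  obtain ⟨N, e, hN, he, hes, hes'⟩ := exists_diffeo_of_compact_support
    (G := fun p => χ p • shearVector p) (hχs.smul contDiff_shearVector) hχc.smul_right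
  have he2 : ∀ p, e p 2 = p 2 := fun p => by rw [he]; simp [shearVector]
  have hpow : ⇑(e ^ N) = e^[N] := Equiv.Perm.coe_pow e N
  refine ⟨e ^ N, ?_, ?_, fun p => ?_, fun p hp => ?_, fun p hp hpw => ?_⟩
  · rw [hpow]; exact contDiff_iterate hes N
  · have : (e ^ N).symm = e⁻¹ ^ N := (inv_pow e N).symm
    rw [this, Equiv.Perm.coe_pow]
    exact contDiff_iterate hes' N
  · rw [hpow]
    generalize N = k
    induction k with
    | zero => rfl
    | succ k ih => rw [Function.iterate_succ_apply', he2, ih]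
  · rw [hpow]
    exact Function.iterate_fixed (by rw [he, hχ0 p hp]; simp) N
  · rw [hpow]
    refine iterate_eq_add_of_segment hN he fun c hc => ?_
    have hq : ‖p + c • shearVector p‖ ≤ 1 / 2 := by
      have := convex_closedBall (0 : E3) (1 / 2) (mem_closedBall_zero_iff.2 hp)
        (mem_closedBall_zero_iff.2 hpw) (sub_nonneg.2 hc.2) hc.1 (by ring)
      have hpt : p + c • shearVector p = (1 - c) • p + c • (p + shearVector p) := by module
      rwa [hpt, ← mem_closedBall_zero_iff]
    rw [hχ1 _ hq, one_smul, shearVector_add_smul]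

/-! ### The height-preserving map -/

theorem contDiff_vec3 {a b c : E3 → ℝ} (ha : ContDiff ℝ ∞ a) (hb : ContDiff ℝ ∞ b)
    (hc : ContDiff ℝ ∞ c) : ContDiff ℝ ∞ fun p => (!₂[a p, b p, c p] : E3) := by
  refine contDiff_euclidean.2 fun i => ?_
  fin_cases i
  · exact ha
  · exact hb
  · exact hc

theorem norm_planar_le_half {a b : ℝ} (ha : |a| ≤ 1 / 5) (hb : |b| ≤ 1 / 5) :
    ‖(!₂[a, b, 0] : E3)‖ ≤ 1 / 2 := by
  have h : ‖(!₂[a, b, 0] : E3)‖ ^ 2 ≤ (1 / 2) ^ 2 := by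
    rw [EuclideanSpace.norm_sq_eq, Fin.sum_univ_three]
    simp
    have := sq_le_sq' (abs_le.1 ha).1 (abs_le.1 ha).2
    have := sq_le_sq' (abs_le.1 hb).1 (abs_le.1 hb).2
    linarith
  exact (abs_le_of_sq_le_sq' h (by norm_num)).2

/-- Near the origin of the middle disc, `F` is the planar map
`(u, v) ↦ (v, foldFun (10 v) / 10 - u)`. -/
def IsFoldNearOrigin (F : BallDiffeo) : Prop :=
  ∀ (p : B3) (u v : ℝ), (p : E3) = !₂[u, v, 0] → |u| ≤ 1 / 5 → |v| ≤ 1 / 5 →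
    |foldFun (10 * v) / 10 - u| ≤ 1 / 5 → (F p : E3) = !₂[v, foldFun (10 * v) / 10 - u, 0]

/-- The map is a quarter turn about the vertical axis followed by the shear. -/
theorem exists_height_preserving_fold :
    ∃ F : BallDiffeo, (∀ p, height (F p) = height p) ∧ IsFoldNearOrigin F := by
  obtain ⟨e, he, he', he2, hout, hin⟩ := exists_shear
  have hball : MapsTo e ball3 ball3 := by
    intro p hp
    by_contra hn
    have h1 : 1 ≤ ‖e p‖ := by
      rw [ball3, mem_closedBall_zero_iff, not_le] at hn; exact hn.le
    rw [e.injective (hout _ h1)] at hn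
    exact hn hp
  have hball' : MapsTo e.symm ball3 ball3 := by
    intro p hp
    by_contra hn
    have h1 : 1 ≤ ‖e.symm p‖ := by
      rw [ball3, mem_closedBall_zero_iff, not_le] at hn; exact hn.le
    have h2 := hout _ h1
    rw [e.apply_symm_apply] at h2
    rw [← h2] at hn
    exact hn hp
  have hc : ∀ i : Fin 3, ContDiff ℝ ∞ fun p : E3 => p i := contDiff_euclidean.1 contDiff_id
  let rot : E3 → E3 := fun p => !₂[p 1, -p 0, p 2]
  let rot' : E3 → E3 := fun p => !₂[-p 1, p 0, p 2]
  have hrot : ContDiff ℝ ∞ rot := contDiff_vec3 (hc 1) (hc 0).neg (hc 2)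
  have hrot' : ContDiff ℝ ∞ rot' := contDiff_vec3 (hc 1).neg (hc 0) (hc 2)
  have mrot : MapsTo rot ball3 ball3 := fun p hp => by
    rw [mem_ball3_iff] at hp ⊢; simp [rot]; linarith
  have mrot' : MapsTo rot' ball3 ball3 := fun p hp => by
    rw [mem_ball3_iff] at hp ⊢; simp [rot']; linarith
  have h1 : ∀ p, rot' (rot p) = p := fun p => by
    ext i; fin_cases i <;> simp [rot, rot']
  have h2 : ∀ p, rot (rot' p) = p := fun p => by
    ext i; fin_cases i <;> simp [rot, rot']
  refine ⟨BallDiffeo.ofMaps (e ∘ rot) (rot' ∘ e.symm) (he.comp hrot).contDiffOn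
    (hrot'.comp he').contDiffOn (hball.comp mrot) (mrot'.comp hball')
    (fun p _ => by simp [h1]) (fun p _ => by simp [h2]), fun p => ?_, ?_⟩
  · show e (rot p) 2 = (p : E3) 2
    rw [he2]; simp [rot]
  · intro p u v hp hu hv hw
    show e (rot p) = _
    have hr : rot p = !₂[v, -u, 0] := by simp [rot, hp]
    have hadd : (!₂[v, -u, 0] : E3) + shearVector !₂[v, -u, 0] =
        !₂[v, foldFun (10 * v) / 10 - u, 0] := by
      ext i; fin_cases i <;> simp [shearVector]; ring
    rw [hr, hin _ (norm_planar_le_half hv (by rwa [abs_neg]))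
      (by rw [hadd]; exact norm_planar_le_half hv hw), hadd]

/-! ### The coded solutions of the second-order recurrence -/

/-- The Green function `4 ^ (-|k|)` of the recurrence
`x (n + 1) + x (n - 1) = 17 / 4 * x n - 15 / 4 * s n`. -/
noncomputable def greenWeight (k : ℤ) : ℝ := (1 / 4) ^ k.natAbs

theorem greenWeight_nonneg (k : ℤ) : 0 ≤ greenWeight k := by unfold greenWeight; positivity

theorem greenWeight_zero : greenWeight 0 = 1 := by simp [greenWeight]

theorem hasSum_greenWeight : HasSum greenWeight (5 / 3) := by
  have h : HasSum (fun n : ℕ => (1 / 4 : ℝ) ^ n) (4 / 3) := by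
    have := hasSum_geometric_of_lt_one (r := (1 / 4 : ℝ)) (by norm_num) (by norm_num)
    norm_num at this ⊢; exact this
  have h1 : HasSum (fun n : ℕ => greenWeight n) (4 / 3) := by simpa [greenWeight] using h
  have h2 : HasSum (fun n : ℕ => greenWeight (-(n + 1 : ℤ))) (1 / 3) := by
    have h3 := h.mul_left (1 / 4)
    norm_num at h3
    refine (by norm_num : (1 / 3 : ℝ) = 1 / 3) ▸ h3.congr_fun ?_
    intro n
    have : (-(n + 1 : ℤ)).natAbs = n + 1 := by omega
    rw [greenWeight, this, pow_succ]; ring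
  have := h1.of_nat_of_neg_add_one h2
  norm_num at this; exact this

theorem greenWeight_recurrence (k : ℤ) :
    greenWeight (k - 1) + greenWeight (k + 1) =
      17 / 4 * greenWeight k - if k = 0 then 15 / 4 else 0 := by
  rcases lt_trichotomy k 0 with h | rfl | h
  · obtain ⟨n, hn⟩ : ∃ n : ℕ, k = -(n + 1 : ℤ) := ⟨(-k - 1).toNat, by omega⟩
    have h1 : (k - 1).natAbs = n + 2 := by omega
    have h2 : (k + 1).natAbs = n := by omega
    have h3 : k.natAbs = n + 1 := by omega
    rw [greenWeight, greenWeight, greenWeight, h1, h2, h3, if_neg h.ne]; ring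
  · norm_num [greenWeight]
  · obtain ⟨n, hn⟩ : ∃ n : ℕ, k = n + 1 := ⟨(k - 1).toNat, by omega⟩
    have h1 : (k - 1).natAbs = n := by omega
    have h2 : (k + 1).natAbs = n + 2 := by omega
    have h3 : k.natAbs = n + 1 := by omega
    rw [greenWeight, greenWeight, greenWeight, h1, h2, h3, if_neg h.ne']; ring

theorem fin_two_eq_zero_or_one (a : Fin 2) : a = 0 ∨ a = 1 := by
  fin_cases a <;> simp

/-- The numerical value of a symbol. -/
def symbolValue (a : Fin 2) : ℝ := (a : ℕ)

theorem symbolValue_mem (a : Fin 2) : symbolValue a ∈ Icc (0 : ℝ) 1 := by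
  fin_cases a <;> simp [symbolValue]

/-- The value at time zero of the bounded solution of
`x (n + 1) + x (n - 1) = 17 / 4 * x n - 15 / 4 * s n`. -/
noncomputable def codedPoint (s : ℤ → Fin 2) : ℝ := ∑' k, greenWeight k * symbolValue (s k)

theorem greenWeight_mul_symbolValue_le (s : ℤ → Fin 2) (k : ℤ) :
    greenWeight k * symbolValue (s k) ≤ greenWeight k :=
  mul_le_of_le_one_right (greenWeight_nonneg k) (symbolValue_mem _).2

theorem greenWeight_mul_symbolValue_nonneg (s : ℤ → Fin 2) (k : ℤ) :
    0 ≤ greenWeight k * symbolValue (s k) :=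
  mul_nonneg (greenWeight_nonneg k) (symbolValue_mem _).1

theorem hasSum_codedPoint (s : ℤ → Fin 2) :
    HasSum (fun k => greenWeight k * symbolValue (s k)) (codedPoint s) :=
  (Summable.of_nonneg_of_le (greenWeight_mul_symbolValue_nonneg s)
    (greenWeight_mul_symbolValue_le s) hasSum_greenWeight.summable).hasSum

theorem codedPoint_nonneg (s : ℤ → Fin 2) : 0 ≤ codedPoint s :=
  tsum_nonneg (greenWeight_mul_symbolValue_nonneg s)

theorem codedPoint_le (s : ℤ → Fin 2) : codedPoint s ≤ 5 / 3 :=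
  hasSum_le (greenWeight_mul_symbolValue_le s) (hasSum_codedPoint s) hasSum_greenWeight

theorem codedPoint_le_of_zero {s : ℤ → Fin 2} (h : s 0 = 0) : codedPoint s ≤ 2 / 3 := by
  have h1 := hasSum_greenWeight.sub (hasSum_codedPoint s)
  have h2 := le_hasSum h1 0 fun k _ => sub_nonneg.2 (greenWeight_mul_symbolValue_le s k)
  norm_num [h, greenWeight_zero, symbolValue] at h2
  linarith

theorem one_le_codedPoint_of_one {s : ℤ → Fin 2} (h : s 0 = 1) : 1 ≤ codedPoint s := by
  have h2 := le_hasSum (hasSum_codedPoint s) 0 fun k _ => greenWeight_mul_symbolValue_nonneg s k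
  simpa [h, greenWeight_zero, symbolValue] using h2

theorem foldFun_codedPoint (s : ℤ → Fin 2) :
    foldFun (codedPoint s) = 17 / 4 * codedPoint s - 15 / 4 * symbolValue (s 0) := by
  rw [foldFun]
  rcases fin_two_eq_zero_or_one (s 0) with h | h
  · rw [Real.smoothTransition.zero_of_nonpos (by linarith [codedPoint_le_of_zero h])]
    simp [h, symbolValue]
  · rw [Real.smoothTransition.one_of_one_le (by linarith [one_le_codedPoint_of_one h])]
    simp [h, symbolValue]

theorem codedPoint_recurrence (s : ℤ → Fin 2) :
    codedPoint (fun n => s (n + 1)) + codedPoint (fun n => s (n - 1)) = foldFun (codedPoint s) := by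
  have h1 : HasSum (fun k => greenWeight (k - 1) * symbolValue (s k))
      (codedPoint fun n => s (n + 1)) := by
    rw [← (Equiv.addRight (1 : ℤ)).hasSum_iff]
    simpa [Function.comp_def] using hasSum_codedPoint fun n => s (n + 1)
  have h2 : HasSum (fun k => greenWeight (k + 1) * symbolValue (s k))
      (codedPoint fun n => s (n - 1)) := by
    rw [← (Equiv.subRight (1 : ℤ)).hasSum_iff]
    simpa [Function.comp_def] using hasSum_codedPoint fun n => s (n - 1)
  have h3 := ((hasSum_codedPoint s).mul_left (17 / 4)).sub
    (hasSum_ite_eq (0 : ℤ) (15 / 4 * symbolValue (s 0)))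
  rw [foldFun_codedPoint]
  refine (h1.add h2).unique (h3.congr_fun fun k => ?_)
  rw [← add_mul, greenWeight_recurrence]
  by_cases hk : k = 0
  · subst hk; simp; ring
  · simp [hk]; ring

theorem continuous_codedPoint : Continuous codedPoint := by
  refine continuous_tsum (fun k => ?_) hasSum_greenWeight.summable fun k s => ?_
  · have : Continuous symbolValue := continuous_of_discreteTopology
    exact continuous_const.mul (this.comp (continuous_apply k))
  · rw [Real.norm_of_nonneg (greenWeight_mul_symbolValue_nonneg s k)]
    exact greenWeight_mul_symbolValue_le s k

theorem third_le_abs_codedPoint_sub {s t : ℤ → Fin 2} (h : s 0 ≠ t 0) :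
    1 / 3 ≤ |codedPoint s - codedPoint t| := by
  rcases fin_two_eq_zero_or_one (s 0) with hs | hs <;>
    rcases fin_two_eq_zero_or_one (t 0) with ht | ht
  · exact absurd (hs.trans ht.symm) h
  · rw [abs_sub_comm]
    exact le_trans (by linarith [codedPoint_le_of_zero hs, one_le_codedPoint_of_one ht])
      (le_abs_self _)
  · exact le_trans (by linarith [codedPoint_le_of_zero ht, one_le_codedPoint_of_one hs])
      (le_abs_self _)
  · exact absurd (hs.trans ht.symm) h

/-! ### The horseshoe -/

theorem abs_codedPoint_div_le (s : ℤ → Fin 2) : |codedPoint s / 10| ≤ 1 / 5 := by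
  rw [abs_le]
  constructor <;> linarith [codedPoint_nonneg s, codedPoint_le s]

/-- Two consecutive terms of a coded solution, as a point of the middle disc. -/
noncomputable def horseshoePoint (s : ℤ → Fin 2) : B3 :=
  ⟨!₂[codedPoint (fun n => s (n - 1)) / 10, codedPoint s / 10, 0], by
    rw [ball3, mem_closedBall_zero_iff]
    exact (norm_planar_le_half (abs_codedPoint_div_le _) (abs_codedPoint_div_le _)).trans
      (by norm_num)⟩

theorem horseshoePoint_apply_one (s : ℤ → Fin 2) :
    (horseshoePoint s : E3) 1 = codedPoint s / 10 := by simp [horseshoePoint]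

theorem continuous_horseshoePoint : Continuous horseshoePoint := by
  have h : Continuous fun s : ℤ → Fin 2 => codedPoint fun n => s (n - 1) :=
    continuous_codedPoint.comp (by fun_prop)
  refine continuous_induced_rng.2 ((PiLp.continuous_toLp 2 _).comp (continuous_pi fun i => ?_))
  fin_cases i
  · exact h.div_const 10
  · exact continuous_codedPoint.div_const 10
  · exact continuous_const

theorem horseshoePoint_mem_slice (s : ℤ → Fin 2) : horseshoePoint s ∈ slice 0 := by
  simp [slice, height, horseshoePoint]

/-- The zeroth symbol is visible on the horseshoe at scale `1 / 60`. -/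
theorem horseshoePoint_separated {s t : ℤ → Fin 2} (h : s 0 ≠ t 0) {z : B3}
    (hs : dist (horseshoePoint s) z < 1 / 60) : 1 / 60 < dist (horseshoePoint t) z := by
  have h1 : |codedPoint s / 10 - codedPoint t / 10| ≤
      dist (horseshoePoint s) (horseshoePoint t) := by
    rw [Subtype.dist_eq, dist_eq_norm, ← horseshoePoint_apply_one, ← horseshoePoint_apply_one]
    exact PiLp.norm_apply_le ((horseshoePoint s : E3) - (horseshoePoint t : E3)) 1
  rw [← sub_div, abs_div, abs_of_pos (by norm_num : (0 : ℝ) < 10)] at h1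
  linarith [third_le_abs_codedPoint_sub h,
    dist_triangle_right (horseshoePoint s) (horseshoePoint t) z]

theorem apply_horseshoePoint {F : BallDiffeo} (hF : IsFoldNearOrigin F) (s : ℤ → Fin 2) :
    F (horseshoePoint s) = horseshoePoint fun n => s (n + 1) := by
  have h10 : 10 * (codedPoint s / 10) = codedPoint s := by ring
  have hnext : foldFun (10 * (codedPoint s / 10)) / 10 - codedPoint (fun n => s (n - 1)) / 10 =
      codedPoint (fun n => s (n + 1)) / 10 := by
    rw [h10, ← codedPoint_recurrence]; ring
  refine Subtype.ext ?_
  rw [hF _ _ _ rfl (abs_codedPoint_div_le _) (abs_codedPoint_div_le _)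
    (by rw [hnext]; exact abs_codedPoint_div_le _), hnext]
  simp [horseshoePoint]

/-- A single point of the horseshoe remembers all symbols, as the dynamics shifts each of them to
the visible position. -/
theorem horseshoePoint_injective {F : BallDiffeo} (hF : IsFoldNearOrigin F) :
    Function.Injective horseshoePoint := by
  intro s t hst
  -- both shifts preserve coincidences: the forward one is `F`, and `F` is injective
  have hall : ∀ n : ℤ, horseshoePoint (fun k => s (k + n)) = horseshoePoint fun k => t (k + n) := by
    intro n
    induction n using Int.induction_on with
    | zero => simpa using hst
    | succ n ih =>
      have := congrArg F ih
      rw [apply_horseshoePoint hF, apply_horseshoePoint hF] at this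
      simpa [add_assoc, add_comm, add_left_comm] using this
    | pred n ih =>
      apply F.toEquiv.injective
      rw [apply_horseshoePoint hF, apply_horseshoePoint hF]
      have h : ∀ k : ℤ, k + 1 + (-n - 1) = k + -n := fun k => by ring
      simpa only [h] using ih
  ext n : 1
  by_contra hne
  have h1 := third_le_abs_codedPoint_sub (s := fun k => s (k + n)) (t := fun k => t (k + n))
    (by simpa using hne)
  have h2 := congrArg (fun p : B3 => (p : E3) 1) (hall n)
  simp only [horseshoePoint_apply_one] at h2
  have h3 : codedPoint (fun k => s (k + n)) - codedPoint (fun k => t (k + n)) = 0 := by linarith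
  rw [h3, abs_zero] at h1
  norm_num at h1

theorem hasHorseshoeIn_middle_slice {F : BallDiffeo} (hF : IsFoldNearOrigin F) :
    HasHorseshoeIn F (slice 0) :=
  ⟨horseshoePoint,
    (continuous_horseshoePoint.isClosedEmbedding (horseshoePoint_injective hF)).isEmbedding,
    range_subset_iff.2 horseshoePoint_mem_slice, apply_horseshoePoint hF⟩

theorem log_two_le_entropy {F : BallDiffeo} (hF : IsFoldNearOrigin F) :
    ((Real.log 2 : ℝ) : EReal) ≤ F.entropy :=
  log_two_le_coverEntropy_of_shift F horseshoePoint (apply_horseshoePoint hF)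
    {q | dist q.1 q.2 < 1 / 60} (Metric.dist_mem_uniformity (by norm_num))
    fun _ _ hst _ hs ht => (horseshoePoint_separated hst hs).not_gt ht

end BallDynamics

theorem theoremE :
    ∃ F : BallDynamics.BallDiffeo,
      ¬ ContinuousAt BallDynamics.BallDiffeo.entropy F ∧
      ¬ LowerSemicontinuousAt BallDynamics.BallDiffeo.entropy F ∧
      (∀ p, BallDynamics.height (F p) = BallDynamics.height p) ∧
      BallDynamics.HasHorseshoeIn F (BallDynamics.slice 0) ∧
      ((Real.log 2 : ℝ) : EReal) ≤ F.entropy ∧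
      ∃ φ : ℝ → BallDynamics.BallDiffeo, BallDynamics.IsNorthSouthFlow φ ∧
        Filter.Tendsto (fun τ => (φ τ).comp F) (nhdsWithin 0 (Set.Ioi 0)) (nhds F) ∧
        ∀ τ > 0,
          BallDynamics.nonwanderingSet ((φ τ).comp F) =
            {BallDynamics.northPole, BallDynamics.southPole} ∧
          ((φ τ).comp F).entropy = 0 := by
  obtain ⟨F, hheight, hF⟩ := BallDynamics.exists_height_preserving_fold
  have hlog := BallDynamics.log_two_le_entropy hF
  have hT : ∀ τ p, BallDynamics.height ((BallDynamics.boostFlow τ).comp F p) =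
      BallDynamics.boostHeight τ (BallDynamics.height p) := fun τ p =>
    (BallDynamics.height_boostFlow τ (F p)).trans (by rw [hheight])
  have hzero : ∀ τ > 0, ((BallDynamics.boostFlow τ).comp F).entropy = 0 := fun τ hτ =>
    BallDynamics.coverEntropy_eq_zero_of_boost hτ (hT τ)
  have hlim := BallDynamics.tendsto_flow_comp BallDynamics.isNorthSouthFlow_boostFlow F
  have hlsc : ¬ LowerSemicontinuousAt BallDynamics.BallDiffeo.entropy F := by
    intro h
    have hpos : (0 : EReal) < F.entropy :=
      lt_of_lt_of_le (by exact_mod_cast Real.log_pos one_lt_two) hlog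
    obtain ⟨τ, hτ, hτ0⟩ := ((hlim.eventually (h 0 hpos)).and self_mem_nhdsWithin).exists
    rw [hzero τ hτ0] at hτ
    exact lt_irrefl _ hτ
  exact ⟨F, fun h => hlsc h.lowerSemicontinuousAt, hlsc, hheight,
    BallDynamics.hasHorseshoeIn_middle_slice hF, hlog, BallDynamics.boostFlow,
    BallDynamics.isNorthSouthFlow_boostFlow, hlim, fun τ hτ =>
      ⟨BallDynamics.nonwanderingSet_eq_poles hτ (hT τ), hzero τ hτ⟩⟩
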